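/- Let $\mathcal A$ be a finite alphabet and $\boldsymbol\sigma=(\sigma_n)_{n\ge 0}$ a sequence of substitutions $\sigma_n:\mathcal A\to\mathcal A^+$ (extended to words and to two-sided sequences by concatenation). Write $\sigma_{[n,N)}=\sigma_n\circ\cdots\circ\sigma_{N-1}$, let $M_\sigma$ be the incidence matrix, whose entry $(i,j)$ is the number of occurrences of $i$ in $\sigma(j)$, let $M_{[n,N)}=M_{\sigma_n}\cdots M_{\sigma_{N-1}}$, and $h_n(a)=|\sigma_{[0,n)}(a)|$. Let $X^{(n)}_{\boldsymbol\sigma}\subset\mathcal A^{\mathbb Z}$ be the set of sequences all of whose finite subwords are subwords of some $\sigma_{[n,N)}(a)$, $a\in\mathcal A$, $N>n$; let $\mathcal L^{(n)}$ be the set of finite subwords of points of $X^{(n)}_{\boldsymbol\sigma}$, let $X_{\boldsymbol\sigma}=X_{\boldsymbol\sigma}^{(0)}$, and let $T$ be the left shift. A word is essential if it lies in $\mathcal L^{(n)}$ for infinitely many $n$. Assume: - $\boldsymbol\sigma$ is finitary: $\{\sigma_n : n\ge 0\}$ is finite; moreover each $\sigma_n$ occurs infinitely often in $\boldsymbol\sigma$;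 - $\boldsymbol\sigma$ is straight: for each essential two-letter word $ab$ there is exactly one $x\in X_{\boldsymbol\sigma}$ that is a limit of the pointed words $\sigma_{[0,n_k)}(a)\cdot\sigma_{[0,n_k)}(b)$ for some strictly increasing sequence $(n_k)$ with $ab\in\mathcal L^{(n_k)}$ for all $k$; - $\boldsymbol\sigma$ is recognizable: for every $n$, each $y\in\mathcal A^{\mathbb Z}$ has at most one representation $y=T^k\sigma_n(x)$ with $x\in X^{(n+1)}_{\boldsymbol\sigma}$ and $0\le k<|\sigma_n(x_0)|$; - $\boldsymbol\sigma$ is primitive: for each $n$ there is $N>n$ such that $M_{[n,N)}$ has positive entries; - every $M_{\sigma_n}$ is invertible (non-zero determinant); - $\boldsymbol\sigma$ is strongly convergent: there is $\boldsymbol u\in\mathbb R_{\ge0}^{\mathcal A}$ with entries summing to $1$ such that $\lim_n \mathrm d(M_{[0,n)}\boldsymbol e_a,\mathbb R^+\boldsymbol u)=0$ for all $a\in\mathcal A$, where $\mathrm d$ is the Euclidean distance and $(\boldsymbol e_a)$ the canonical basis. Let $\mu$ be the (unique) shift-invariant Borel probability measure on $X_{\boldsymbol\sigma}$ and $\mu[a]=\mu\{x: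 x_0=a\}$. Let $t\in\mathbb R$ and $\lambda=e^{2\pi i t}$ be such that $\lim_n\lambda^{h_n(a)}=1$ for every $a\in\mathcal A$. Then: 1. $t$ is a $\mathbb Q$-linear combination of the numbers $\mu[a]$, $a\in\mathcal A$; and if $\boldsymbol\sigma$ is unimodular (all $\det M_{\sigma_n}=\pm1$), then $t$ is a $\mathbb Z$-linear combination of them. 2. Suppose in addition that $\sum_n\max_{a}\mathrm d(M_{[0,n)}\boldsymbol e_a,\mathbb R\boldsymbol u)<\infty$. Then $\lambda$ is a continuous eigenvalue of $(X_{\boldsymbol\sigma},T)$, that is, there is a continuous $f:X_{\boldsymbol\sigma}\to\mathbb C$, not identically zero, with $f\circ T=\lambda f$. Moreover, for each letter $a$ such that $\sum_n\mathrm d(M_{[0,n)}\boldsymbol e_a,\mathbb R\boldsymbol u)<\infty$ (in the present situation, every letter), $\mu[a]$ is an additive continuous eigenvalue, that is, $e^{2\pi i\mu[a]}$ is a continuous eigenvalue of $(X_{\boldsymbol\sigma},T)$. -/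

import Mathlib

open Filter Topology MeasureTheory

namespace SAdic

/-- A substitution on the alphabet `A`: every letter is mapped to a non-empty word. -/
structure Substitution (A : Type*) where
  toFun : A → List A
  ne_nil : ∀ a, toFun a ≠ []

/-- The left shift `T` on two-sided sequences. -/
def shift {A : Type*} (x : ℤ → A) : ℤ → A := fun i => x (i + 1)

/-- The subword `x_{[k, k+l)}` of a two-sided sequence. -/
def window {A : Type*} (x : ℤ → A) (k : ℤ) (l : ℕ) : List A :=
  (List.range l).map fun i : ℕ => x (k + (i : ℤ))

namespace Substitution

/-- The extension of a substitution to finite words, by concatenation. -/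
def onWord {A : Type*} (s : Substitution A) (w : List A) : List A := w.flatMap s.toFun

theorem length_le_onWord {A : Type*} (s : Substitution A) (w : List A) :
    w.length ≤ (s.onWord w).length := by
  induction w with
  | nil => simp
  | cons a w ih =>
    have h : 0 < (s.toFun a).length := List.length_pos_of_ne_nil (s.ne_nil a)
    simp only [onWord, List.flatMap_cons, List.length_append, List.length_cons] at ih ⊢
    omega

/-- The extension of a substitution to two-sided sequences,
`… s(x₋₂) s(x₋₁) . s(x₀) s(x₁) …`, where `s(x₀)` starts at position `0`:
the entry at `i ≥ 0` is the `i`-th letter of `s(x₀ ⋯ xᵢ)`, and the entry at `-(i+1) < 0` is the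
letter of `s(x₋ᵢ₋₁ ⋯ x₋₁)` that is `i`-th from its right end. -/
def onSeq {A : Type*} (s : Substitution A) (x : ℤ → A) : ℤ → A
  | Int.ofNat i => (s.onWord (window x 0 (i + 1)))[i]'(by
      have h := s.length_le_onWord (window x 0 (i + 1))
      simp only [window, List.length_map, List.length_range] at h ⊢
      omega)
  | Int.negSucc i => (s.onWord (window x (Int.negSucc i) (i + 1))).reverse[i]'(by
      have h := s.length_le_onWord (window x (Int.negSucc i) (i + 1))
      simp only [window, List.length_map, List.length_range, List.length_reverse] at h ⊢
      omega)

/-- The incidence matrix: the entry `(i, j)` is the number of occurrences of `i` in `s(j)`. -/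
def incidence {A : Type*} [DecidableEq A] (s : Substitution A) : Matrix A A ℝ :=
  Matrix.of fun i j => ((s.toFun j).count i : ℝ)

/-- `s` is recognizable in `X`: a two-sided sequence has at most one representation `T^k s(x)`
with `x ∈ X` and `0 ≤ k < |s(x₀)|`. -/
def RecognizableIn {A : Type*} (s : Substitution A) (X : Set (ℤ → A)) : Prop :=
  ∀ (x x' : ℤ → A) (k k' : ℕ), x ∈ X → x' ∈ X →
    k < (s.toFun (x 0)).length → k' < (s.toFun (x' 0)).length →
    shift^[k] (s.onSeq x) = shift^[k'] (s.onSeq x') → k = k' ∧ x = x'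

end Substitution

/-- The word `σ_{[n, n+k)}(a) = (σ_n ∘ σ_{n+1} ∘ ⋯ ∘ σ_{n+k-1})(a)`. -/
def block {A : Type*} (σ : ℕ → Substitution A) (n : ℕ) : ℕ → A → List A
  | 0, a => [a]
  | k + 1, a => ((σ (n + k)).toFun a).flatMap (block σ n k)

/-- The height `h_n(a) = |σ_{[0,n)}(a)|`. -/
def height {A : Type*} (σ : ℕ → Substitution A) (n : ℕ) (a : A) : ℕ := (block σ 0 n a).length

/-- The words that are subwords of some `σ_{[n,N)}(a)` with `N > n`. -/
def preLanguage {A : Type*} (σ : ℕ → Substitution A) (n : ℕ) : Set (List A) :=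
  {w | ∃ (a : A) (k : ℕ), 1 ≤ k ∧ w <:+: block σ n k a}

/-- The level-`n` shift: the two-sided sequences all of whose subwords are in
`preLanguage σ n`. -/
def levelShift {A : Type*} (σ : ℕ → Substitution A) (n : ℕ) : Set (ℤ → A) :=
  {x | ∀ (k : ℤ) (l : ℕ), window x k l ∈ preLanguage σ n}

/-- The level-`n` language: the subwords of points of the level-`n` shift. -/
def language {A : Type*} (σ : ℕ → Substitution A) (n : ℕ) : Set (List A) :=
  {w | ∃ x ∈ levelShift σ n, ∃ (k : ℤ) (l : ℕ), w = window x k l}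

/-- The product `M_{[n, n+k)}` of incidence matrices. -/
def incidenceProd {A : Type*} [Fintype A] [DecidableEq A] (σ : ℕ → Substitution A) (n k : ℕ) :
    Matrix A A ℝ :=
  ((List.range k).map fun i : ℕ => (σ (n + i)).incidence).prod

/-- Only finitely many substitutions occur in the directive sequence. -/
def Finitary {A : Type*} (σ : ℕ → Substitution A) : Prop := (Set.range σ).Finite

/-- For each `n` there is `N > n` such that `M_{[n,N)}` has positive entries. -/
def Primitive {A : Type*} [Fintype A] [DecidableEq A] (σ : ℕ → Substitution A) : Prop :=
  ∀ n, ∃ k, 1 ≤ k ∧ ∀ i j, 0 < incidenceProd σ n k i j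

/-- `σ_n` is recognizable in the shift of level `n + 1`, for every `n`. -/
def Recognizable {A : Type*} (σ : ℕ → Substitution A) : Prop :=
  ∀ n, (σ n).RecognizableIn (levelShift σ (n + 1))

/-- A word is essential if it occurs in the languages of infinitely many levels. -/
def Essential {A : Type*} (σ : ℕ → Substitution A) (w : List A) : Prop :=
  ∃ᶠ n in atTop, w ∈ language σ n

/-- The set `𝐚·𝐛` of limit words: the points `u` of the shift such that
`σ_{[0,n_k)}(a) . σ_{[0,n_k)}(b)` converges to `u`, for some strictly increasing `(n_k)` with `ab`
in the language of level `n_k` for all `k`. -/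
def limitWords {A : Type*} (σ : ℕ → Substitution A) (a b : A) : Set (ℤ → A) :=
  {u | u ∈ levelShift σ 0 ∧ ∃ n : ℕ → ℕ, StrictMono n ∧ (∀ k, [a, b] ∈ language σ (n k)) ∧
    (∀ i : ℕ, ∀ᶠ k in atTop, (block σ 0 (n k) b)[i]? = some (u (i : ℤ))) ∧
    (∀ i : ℕ, ∀ᶠ k in atTop, (block σ 0 (n k) a).reverse[i]? = some (u (-1 - (i : ℤ))))}

/-- For each essential two-letter word `ab`, the set `𝐚·𝐛` is a singleton. -/
def Straight {A : Type*} (σ : ℕ → Substitution A) : Prop :=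
  ∀ a b, Essential σ [a, b] → ∃ u, limitWords σ a b = {u}

/-- All incidence matrices have determinant `±1`. -/
def Unimodular {A : Type*} [Fintype A] [DecidableEq A] (σ : ℕ → Substitution A) : Prop :=
  ∀ n, (σ n).incidence.det = 1 ∨ (σ n).incidence.det = -1

/-- The vector `M_{[0,n)} e_a`, in Euclidean space. -/
noncomputable def column {A : Type*} [Fintype A] [DecidableEq A] (σ : ℕ → Substitution A)
    (n : ℕ) (a : A) : EuclideanSpace ℝ A :=
  WithLp.toLp 2 fun i => incidenceProd σ 0 n i a

/-- The Euclidean distance of `M_{[0,n)} e_a` to the line `ℝu`. -/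
noncomputable def distToLine {A : Type*} [Fintype A] [DecidableEq A] (σ : ℕ → Substitution A)
    (u : EuclideanSpace ℝ A) (n : ℕ) (a : A) : ℝ :=
  Metric.infDist (column σ n a) {v | ∃ r : ℝ, v = r • u}

/-- `σ` is strongly convergent with respect to the normalised non-negative vector `u`. -/
def StronglyConvergent {A : Type*} [Fintype A] [DecidableEq A] (σ : ℕ → Substitution A)
    (u : EuclideanSpace ℝ A) : Prop :=
  (∀ a, 0 ≤ u a) ∧ ∑ a, u a = 1 ∧
    ∀ a, Tendsto (fun n => Metric.infDist (column σ n a) {v | ∃ r : ℝ, 0 < r ∧ v = r • u})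
      atTop (𝓝 0)

/-- `l` is a continuous eigenvalue of the shift `(X, T)`: there is a continuous function on `X`,
not identically zero, with `f ∘ T = l f` on `X`. -/
def IsContinuousEigenvalue {A : Type*} [TopologicalSpace A] (X : Set (ℤ → A)) (l : ℂ) : Prop :=
  ∃ f : (ℤ → A) → ℂ, ContinuousOn f X ∧ (∃ x ∈ X, f x ≠ 0) ∧ ∀ x ∈ X, f (shift x) = l * f x

/-- `t` is an additive continuous eigenvalue if `e^{2πit}` is a continuous eigenvalue. -/
def IsAdditiveContinuousEigenvalue {A : Type*} [TopologicalSpace A] (X : Set (ℤ → A)) (t : ℝ) :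
    Prop :=
  IsContinuousEigenvalue X (Complex.exp (2 * Real.pi * Complex.I * t))

/-- `μ` is a shift-invariant Borel probability measure carried by `X`. -/
structure IsInvariantProbability {A : Type*} [MeasurableSpace A] (X : Set (ℤ → A))
    (μ : Measure (ℤ → A)) : Prop where
  isProbability : IsProbabilityMeasure μ
  invariant : MeasurePreserving shift μ μ
  carried : ∀ᵐ x ∂μ, x ∈ X

/-- The measure `μ[a]` of the one-letter cylinder of `a`. -/
noncomputable def letterMeasure {A : Type*} [MeasurableSpace A] (μ : Measure (ℤ → A)) (a : A) : ℝ :=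
  μ.real {x | x 0 = a}

end SAdic

/-! ### Windows and images of two-sided sequences. -/

namespace SAdic

variable {A : Type*}

/-! Write `z_n(a)` for the integer nearest to `t h_n(a)`. The hypothesis makes `|t h_n(a) - z_n(a)|`
small. Height vectors satisfy `h_{n+1} = h_n M_{σ_n}`, and the column sums of `M_{σ_n}` are bounded
because `σ` is finitary. So for large `n` the integer vectors `z_n M_{σ_n}` and `z_{n+1}` differ by
less than 1 in each entry, and therefore agree. Hence `z_n = q M_{[0,n)}` for all large `n`, with a
fixed `q` that is rational, and integral in the unimodular case (`exists_rat_weights`). The vector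
`t·1 - q` then has pairings tending to 0 with the columns of `M_{[0,n)}`. These columns approach the
line `ℝu` and have norm bounded below, so `t·1 - q` is orthogonal to `u`, that is, `t = ∑ q_i u_i`.
Uniform letter frequencies give `μ[a] = u_a` (`letterMeasure_eq`).

For the second claim, let `t = ∑ w_i u_i`, where `w` pairs integrally with the columns. By
Cauchy–Schwarz the distance from `t h_n(a)` to an integer is at most a constant times the distance
of the column to `ℝu`, so `∑ |λ^{h_n(a)} - 1|` converges. The eigenfunction is the uniform limit of
`λ^{r_n(x)}`, where `r_n(x)` is the position of the origin of `x` in its level-`n` tower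
(`isContinuousEigenvalue_of_summable`). The choice `w = q` serves `t`, and `w = e_a` serves `μ[a]`.
-/

@[simp] theorem length_window (x : ℤ → A) (k : ℤ) (l : ℕ) : (window x k l).length = l := by
  simp [window]

@[simp] theorem getElem_window (x : ℤ → A) (k : ℤ) (l i : ℕ) (h : i < (window x k l).length) :
    (window x k l)[i] = x (k + i) := by
  simp [window]

@[simp] theorem window_zero (x : ℤ → A) (k : ℤ) : window x k 0 = [] := by
  simp [window]

theorem window_add (x : ℤ → A) (k : ℤ) (l m : ℕ) :
    window x k (l + m) = window x k l ++ window x (k + l) m := by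
  simp [window, List.range_add, Function.comp_def, add_assoc]

theorem window_one (x : ℤ → A) (k : ℤ) : window x k 1 = [x k] := by
  simp [window]

theorem window_succ (x : ℤ → A) (k : ℤ) (l : ℕ) :
    window x k (l + 1) = window x k l ++ [x (k + l)] := by
  rw [window_add, window_one]

theorem window_succ' (x : ℤ → A) (k : ℤ) (l : ℕ) :
    window x k (l + 1) = x k :: window x (k + 1) l := by
  rw [add_comm, window_add, window_one]; simp

theorem window_shift (x : ℤ → A) (k : ℤ) (l : ℕ) :
    window (shift x) k l = window x (k + 1) l := by
  apply List.ext_getElem <;> simp [shift, add_right_comm]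

theorem window_eq_iff {x : ℤ → A} {k : ℤ} {w : List A} :
    window x k w.length = w ↔ ∀ (i : ℕ) (h : i < w.length), x (k + i) = w[i] := by
  constructor
  · intro h i hi
    have := List.getElem_of_eq h (i := i) (by simpa using hi)
    simpa using this
  · intro h
    apply List.ext_getElem (by simp)
    intro i h1 h2
    simp [h i h2]

theorem shift_iterate_apply (x : ℤ → A) (k : ℕ) (i : ℤ) : shift^[k] x i = x (i + k) := by
  induction k generalizing x with
  | zero => simp
  | succ k ih => rw [Function.iterate_succ_apply, ih]; simp [shift, add_assoc]

namespace Substitution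

variable (s : Substitution A)

@[simp] theorem onWord_nil : s.onWord [] = [] := rfl

@[simp] theorem onWord_append (v w : List A) : s.onWord (v ++ w) = s.onWord v ++ s.onWord w := by
  simp [onWord]

@[simp] theorem onWord_cons (a : A) (w : List A) : s.onWord (a :: w) = s.toFun a ++ s.onWord w := by
  simp [onWord]

theorem toFun_length_pos (a : A) : 0 < (s.toFun a).length := List.length_pos_of_ne_nil (s.ne_nil a)

theorem length_onWord_le {K : ℕ} (hK : ∀ a, (s.toFun a).length ≤ K) (w : List A) :
    (s.onWord w).length ≤ K * w.length := by
  induction w with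
  | nil => simp
  | cons a w ih =>
    have := hK a
    simp only [onWord_cons, List.length_append, List.length_cons, mul_add, mul_one]
    omega

/-- The position in `s.onSeq y` at which the image of the letter `y j` starts. -/
def cellStart (y : ℤ → A) : ℤ → ℤ
  | Int.ofNat j => ((s.onWord (window y 0 j)).length : ℤ)
  | Int.negSucc j => -((s.onWord (window y (Int.negSucc j) (j + 1))).length : ℤ)

@[simp] theorem cellStart_zero (y : ℤ → A) : s.cellStart y 0 = 0 := by
  change (((s.onWord (window y 0 0)).length : ℕ) : ℤ) = 0
  simp

theorem cellStart_succ (y : ℤ → A) (j : ℤ) :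
    s.cellStart y (j + 1) = s.cellStart y j + (s.toFun (y j)).length := by
  match j with
  | Int.ofNat j =>
    change (((s.onWord (window y 0 (j + 1))).length : ℕ) : ℤ) =
      (((s.onWord (window y 0 j)).length : ℕ) : ℤ) + _
    rw [window_succ]
    simp
  | Int.negSucc 0 =>
    change s.cellStart y 0 = -(((s.onWord (window y (-1) 1)).length : ℕ) : ℤ) + _
    simp [window_one]
  | Int.negSucc (j + 1) =>
    have h : Int.negSucc (j + 1) + 1 = Int.negSucc j := by omega
    rw [h]
    change -(((s.onWord (window y (Int.negSucc j) (j + 1))).length : ℕ) : ℤ) =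
      -(((s.onWord (window y (Int.negSucc (j + 1)) (j + 1 + 1))).length : ℕ) : ℤ) + _
    rw [window_succ' y (Int.negSucc (j + 1)), h]
    simp

theorem cellStart_add (y : ℤ → A) (j : ℤ) (l : ℕ) :
    s.cellStart y (j + l) = s.cellStart y j + (s.onWord (window y j l)).length := by
  induction l with
  | zero => simp
  | succ l ih =>
    rw [Nat.cast_succ, ← add_assoc, cellStart_succ, ih, window_succ]
    simp [add_assoc]

/-- With `exists_cell`, this determines `s.onSeq y` cell by cell, so later arguments need not split
on the sign of the position. -/
theorem onSeq_cell (y : ℤ → A) (j : ℤ) (i : ℕ) (hi : i < (s.toFun (y j)).length) :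
    s.onSeq y (s.cellStart y j + i) = (s.toFun (y j))[i] := by
  match j with
  | Int.ofNat j =>
    have key : ∀ N : ℕ, N = (s.onWord (window y 0 j)).length + i →
        s.onSeq y (Int.ofNat N) = (s.toFun (y j))[i] := by
      intro N hN
      have hi' : i < (s.toFun (y (j : ℤ))).length := hi
      have hj := s.length_le_onWord (window y 0 j)
      rw [length_window] at hj
      -- Images are non-empty, so `j ≤ N` and the window that defines entry `N` contains the letter
      -- `y j`.
      obtain ⟨m, hm⟩ : ∃ m, N + 1 = j + 1 + m := ⟨N - j, by omega⟩
      have hw : s.onWord (window y 0 (N + 1)) = s.onWord (window y 0 j) ++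
          (s.toFun (y j) ++ s.onWord (window y (0 + ((j + 1 : ℕ) : ℤ)) m)) := by
        rw [hm, window_add, window_succ]
        simp
      simp only [onSeq, hw]
      rw [List.getElem_append_right (by omega), List.getElem_append_left (by omega)]
      congr 1
      omega
    exact key _ rfl
  | Int.negSucc m =>
    -- Negative positions are read from the right: `q` counts the letters strictly between this
    -- entry and the origin.
    obtain ⟨q, hq⟩ : ∃ q, q = (s.onWord (window y (-(m : ℤ)) m)).length +
      ((s.toFun (y (Int.negSucc m))).length - 1 - i) := ⟨_, rfl⟩
    have h1 : Int.negSucc m + 1 = -(m : ℤ) := by omega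
    have hP : s.cellStart y (Int.negSucc m) + i = Int.negSucc q := by
      change -(((s.onWord (window y (Int.negSucc m) (m + 1))).length : ℕ) : ℤ) + _ = _
      rw [window_succ', h1]
      simp
      omega
    have hj := s.length_le_onWord (window y (-(m : ℤ)) m)
    rw [length_window] at hj
    obtain ⟨r, hr⟩ : ∃ r, q + 1 = r + (1 + m) := ⟨q - m, by omega⟩
    have h2 : Int.negSucc q + (r : ℤ) = Int.negSucc m := by omega
    have hw : s.onWord (window y (Int.negSucc q) (q + 1)) = s.onWord (window y (Int.negSucc q) r) ++
        (s.toFun (y (Int.negSucc m)) ++ s.onWord (window y (-(m : ℤ)) m)) := by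
      rw [hr, window_add, h2, window_add, window_one]
      push_cast
      rw [h1]
      simp
    rw [hP]
    simp only [onSeq]
    rw [List.getElem_reverse]
    simp only [hw, List.length_append]
    rw [List.getElem_append_right (by omega), List.getElem_append_left (by omega)]
    congr 1
    omega

theorem exists_cell (y : ℤ → A) (z : ℤ) :
    ∃ (j : ℤ) (i : ℕ), i < (s.toFun (y j)).length ∧ z = s.cellStart y j + i := by
  induction z using Int.induction_on with
  | zero => exact ⟨0, 0, s.toFun_length_pos _, by simp⟩
  | succ z ih =>
    obtain ⟨j, i, hi, hz⟩ := ih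
    by_cases h : i + 1 < (s.toFun (y j)).length
    · exact ⟨j, i + 1, h, by push_cast; omega⟩
    · refine ⟨j + 1, 0, s.toFun_length_pos _, ?_⟩
      rw [cellStart_succ]
      omega
  | pred z ih =>
    obtain ⟨j, i, hi, hz⟩ := ih
    by_cases h : 0 < i
    · exact ⟨j, i - 1, by omega, by omega⟩
    · have h1 := s.cellStart_succ y (j - 1)
      have h2 := s.toFun_length_pos (y (j - 1))
      rw [sub_add_cancel] at h1
      exact ⟨j - 1, (s.toFun (y (j - 1))).length - 1, by omega, by omega⟩

theorem onSeq_shift (y : ℤ → A) :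
    s.onSeq (shift y) = shift^[(s.toFun (y 0)).length] (s.onSeq y) := by
  have hP : ∀ j, s.cellStart (shift y) j = s.cellStart y (j + 1) - (s.toFun (y 0)).length := by
    intro j
    induction j using Int.induction_on with
    | zero =>
      rw [cellStart_succ]
      simp
    | succ j ih =>
      rw [cellStart_succ, ih, s.cellStart_succ y (j + 1), shift]
      ring
    | pred j ih =>
      have h1 := s.cellStart_succ (shift y) (-(j : ℤ) - 1)
      have h2 := s.cellStart_succ y (-(j : ℤ) - 1 + 1)
      simp only [sub_add_cancel, shift] at h1 h2 ⊢
      omega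
  funext z
  obtain ⟨j, i, hi, rfl⟩ := s.exists_cell (shift y) z
  rw [onSeq_cell s _ _ _ hi, shift_iterate_apply, hP]
  rw [show s.cellStart y (j + 1) - (s.toFun (y 0)).length + (i : ℤ) + (s.toFun (y 0)).length
    = s.cellStart y (j + 1) + i by ring]
  exact (s.onSeq_cell y (j + 1) i hi).symm

theorem window_onSeq (y : ℤ → A) (j : ℤ) (l : ℕ) :
    window (s.onSeq y) (s.cellStart y j) (s.onWord (window y j l)).length =
      s.onWord (window y j l) := by
  induction l with
  | zero => simp
  | succ l ih =>
    rw [window_succ, onWord_append, List.length_append, window_add, ih, ← cellStart_add]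
    congr 1
    simp only [onWord_cons, onWord_nil, List.append_nil]
    rw [window_eq_iff]
    exact fun i hi => s.onSeq_cell y _ i hi

theorem onSeq_ofNat (y : ℤ → A) (i : ℕ) (hi : i < (s.toFun (y 0)).length) :
    s.onSeq y i = (s.toFun (y 0))[i] := by
  simpa using s.onSeq_cell y 0 i hi

end Substitution

section Topology

theorem continuous_shift [TopologicalSpace A] : Continuous (shift : (ℤ → A) → (ℤ → A)) :=
  continuous_pi fun i => continuous_apply (i + 1)

variable [TopologicalSpace A] [DiscreteTopology A]

theorem isLocallyConstant_window (k : ℤ) (l : ℕ) :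
    IsLocallyConstant fun x : ℤ → A => window x k l := by
  rw [IsLocallyConstant.iff_eventually_eq]
  intro x
  have hc : ∀ j : ℤ, Continuous fun y : ℤ → A => y j := fun j => continuous_apply j
  have h : ∀ i ∈ Finset.range l, ∀ᶠ y in 𝓝 x, y (k + (i : ℤ)) = x (k + (i : ℤ)) := fun i _ =>
    (hc (k + i)).continuousAt.eventually (p := fun b => b = x (k + i))
      (by rw [nhds_discrete]; exact Filter.eventually_pure.2 rfl)
  filter_upwards [(Filter.eventually_all_finset _).2 h] with y hy
  apply List.ext_getElem (by simp)
  intro i h1 h2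
  simpa using hy i (by simpa using h1)

theorem Substitution.continuous_onSeq (s : Substitution A) : Continuous s.onSeq := by
  refine continuous_pi fun i => IsLocallyConstant.continuous ?_
  rw [IsLocallyConstant.iff_eventually_eq]
  intro x
  match i with
  | Int.ofNat i =>
    filter_upwards [(isLocallyConstant_window 0 (i + 1)).eventually_eq x] with y hy
    simp only [Substitution.onSeq, hy]
  | Int.negSucc i =>
    filter_upwards [(isLocallyConstant_window (Int.negSucc i) (i + 1)).eventually_eq x] with y hy
    simp only [Substitution.onSeq, hy]

end Topology

end SAdic

/-! ### Desubstitution: existence by compactness, continuity by recognizability. -/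

namespace SAdic

variable {A : Type*}

theorem block_add (σ : ℕ → Substitution A) (n k m : ℕ) (a : A) :
    block σ n (k + m) a = (block σ (n + k) m a).flatMap (block σ n k) := by
  induction m generalizing a with
  | zero => simp [block]
  | succ m ih =>
    rw [← add_assoc, block, block, List.flatMap_assoc, add_assoc n k m]
    congr 1
    funext b
    exact ih b

theorem block_one (σ : ℕ → Substitution A) (n : ℕ) (a : A) : block σ n 1 a = (σ n).toFun a := by
  have h : block σ n 0 = fun b => [b] := rfl
  rw [block, h]
  simp

theorem block_one_add (σ : ℕ → Substitution A) (n m : ℕ) (a : A) :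
    block σ n (1 + m) a = (σ n).onWord (block σ (n + 1) m a) := by
  rw [block_add, Substitution.onWord]
  congr 1
  funext b
  exact block_one σ n b

theorem shift_mem_levelShift {σ : ℕ → Substitution A} {n : ℕ} {x : ℤ → A}
    (hx : x ∈ levelShift σ n) : shift x ∈ levelShift σ n := fun k l => by
  rw [window_shift]
  exact hx _ _

namespace Substitution

theorem exists_split_of_lt_length (s : Substitution A) (v : List A) (e : ℕ)
    (he : e < (s.onWord v).length) :
    ∃ (v₁ : List A) (b : A) (v₂ : List A) (i : ℕ), v = v₁ ++ b :: v₂ ∧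
      e = (s.onWord v₁).length + i ∧ i < (s.toFun b).length := by
  induction v generalizing e with
  | nil => simp at he
  | cons a v ih =>
    by_cases h : e < (s.toFun a).length
    · exact ⟨[], a, v, e, rfl, by simp, h⟩
    · rw [onWord_cons, List.length_append] at he
      obtain ⟨v₁, b, v₂, i, rfl, h1, h2⟩ := ih (e - (s.toFun a).length) (by omega)
      refine ⟨a :: v₁, b, v₂, i, rfl, ?_, h2⟩
      rw [onWord_cons, List.length_append]
      omega

theorem continuous_shift_iterate_onSeq [TopologicalSpace A] [DiscreteTopology A]
    (s : Substitution A) :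
    Continuous fun p : (ℤ → A) × ℕ => shift^[p.2] (s.onSeq p.1) :=
  continuous_prod_of_discrete_right.2 fun k => (continuous_shift.iterate k).comp s.continuous_onSeq

end Substitution

theorem isClosed_setOf_window_mem [TopologicalSpace A] [DiscreteTopology A] (k : ℤ) (l : ℕ)
    (S : Set (List A)) : IsClosed {x : ℤ → A | window x k l ∈ S} :=
  ⟨isLocallyConstant_window k l Sᶜ⟩

theorem isClosed_levelShift [TopologicalSpace A] [DiscreteTopology A] (σ : ℕ → Substitution A)
    (n : ℕ) : IsClosed (levelShift σ n) := by
  simp only [levelShift, Set.ofPred_forall]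
  exact isClosed_iInter fun k => isClosed_iInter fun l => isClosed_setOf_window_mem k l _

theorem isClosed_setOf_lt_length [TopologicalSpace A] [DiscreteTopology A] (s : Substitution A) :
    IsClosed {p : (ℤ → A) × ℕ | p.2 < (s.toFun (p.1 0)).length} := by
  have h : Continuous fun p : (ℤ → A) × ℕ => (p.2, p.1 0) :=
    continuous_snd.prodMk ((continuous_apply 0).comp continuous_fst)
  exact (isClosed_discrete {q : ℕ × A | q.1 < (s.toFun q.2).length}).preimage h

/-- A long window of `x` around the origin lies in some `σ_n(v)`, with `v` a block of level `n + 1`.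
Recentring `v` at the letter whose image covers the origin gives a preimage that is correct on `[-m,
m]`. -/
theorem exists_local_desubstitution {σ : ℕ → Substitution A} {n K : ℕ}
    (hK : ∀ a, ((σ n).toFun a).length ≤ K) {x : ℤ → A} (hx : x ∈ levelShift σ n) (m : ℕ) :
    ∃ (y : ℤ → A) (k : ℕ), k < ((σ n).toFun (y 0)).length ∧
      (∀ i : ℤ, |i| ≤ m → shift^[k] ((σ n).onSeq y) i = x i) ∧
      ∀ (j : ℤ) (l : ℕ), -(m : ℤ) ≤ j → j + l ≤ m → window y j l ∈ preLanguage σ (n + 1) := by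
  obtain ⟨a, k, hk, hinf⟩ := hx (-((K * (m + 2) : ℕ) : ℤ)) (2 * (K * (m + 2)) + 1)
  set R := K * (m + 2) with hR
  have hR' : R = K * m + 2 * K := by rw [hR]; ring
  have hlen := hinf.length_le
  rw [length_window] at hlen
  obtain ⟨k', rfl⟩ : ∃ k', k = 1 + k' := ⟨k - 1, by omega⟩
  -- The window is longer than any `σ_n(a)`, so it cannot come from a one-step block; `preLanguage σ
  -- (n + 1)` needs `k' ≥ 1`.
  have hk' : 1 ≤ k' := by
    by_contra h0
    obtain rfl : k' = 0 := by omega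
    rw [add_zero, block_one] at hlen
    have := hK a
    omega
  rw [block_one_add] at hinf
  set v := block σ (n + 1) k' a with hv
  obtain ⟨p, q, hpq⟩ := hinf
  have hpl := congrArg List.length hpq
  simp only [List.length_append, length_window] at hpl
  obtain ⟨v₁, b, v₂, i, hv', hi, hib⟩ := (σ n).exists_split_of_lt_length v (p.length + R) (by omega)
  have hv₁ := (σ n).length_onWord_le hK v₁
  have hv₂ := (σ n).length_onWord_le hK v₂
  have hb := hK b
  have hvl : ((σ n).onWord v).length =
      ((σ n).onWord v₁).length + (((σ n).toFun b).length + ((σ n).onWord v₂).length) := by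
    rw [hv']; simp
  -- Each letter contributes at most `K` letters to the image, and `R = K(m + 2)` leaves room for
  -- the partial cell at the origin.
  have hm₁ : m ≤ v₁.length := by
    by_contra h
    have : K * (v₁.length + 1) ≤ K * m := Nat.mul_le_mul_left K (by omega)
    rw [mul_add, mul_one] at this
    omega
  have hm₂ : m ≤ v₂.length := by
    by_contra h
    have : K * (v₂.length + 1) ≤ K * m := Nat.mul_le_mul_left K (by omega)
    rw [mul_add, mul_one] at this
    omega
  have hvl' : v.length = v₁.length + (1 + v₂.length) := by
    rw [hv']; simp; omega
  -- The values of `y` outside the range of `v` are arbitrary and never used.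
  let y : ℤ → A := fun z => v.getD (v₁.length + z).toNat b
  have hy : ∀ (e : ℕ) (h : e < v.length), y (-(v₁.length : ℤ) + e) = v[e] := by
    intro e h
    simp only [y]
    rw [show ((v₁.length : ℤ) + (-(v₁.length : ℤ) + e)).toNat = e by omega]
    simp [h]
  have hy0 : y 0 = b := by
    have := hy v₁.length (by omega)
    simpa [hv'] using this
  have hwin : window y (-(v₁.length : ℤ)) v.length = v := window_eq_iff.2 hy
  have hwin₁ : window y (-(v₁.length : ℤ)) v₁.length = v₁ := by
    refine window_eq_iff.2 fun e h => ?_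
    rw [hy e (by omega)]
    simp [hv', h]
  have hcell : (σ n).cellStart y (-(v₁.length : ℤ)) = -(((σ n).onWord v₁).length : ℤ) := by
    have := (σ n).cellStart_add y (-(v₁.length : ℤ)) v₁.length
    rw [hwin₁, neg_add_cancel, Substitution.cellStart_zero] at this
    omega
  have hon := (σ n).window_onSeq y (-(v₁.length : ℤ)) v.length
  rw [hwin, hcell] at hon
  refine ⟨y, i, by rwa [hy0], ?_, ?_⟩
  · intro z hz
    rw [abs_le] at hz
    have hmR : m ≤ R := by
      have hK1 : 1 ≤ K := by omega
      have := Nat.mul_le_mul_right m hK1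
      omega
    obtain ⟨e, he⟩ : ∃ e : ℕ, (e : ℤ) = R + z := ⟨(R + z).toNat, by omega⟩
    have he2 : e < 2 * R + 1 := by omega
    rw [shift_iterate_apply]
    have h1 := window_eq_iff.1 hon (p.length + e) (by omega)
    rw [show -(((σ n).onWord v₁).length : ℤ) + ((p.length + e : ℕ) : ℤ) = z + i by
      push_cast; omega] at h1
    rw [h1]
    simp only [← hpq]
    rw [List.getElem_append_left (by simp; omega), List.getElem_append_right (by omega)]
    simp only [getElem_window]
    congr 1
    omega
  · intro j l hj hl
    refine ⟨a, k', hk', ?_⟩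
    rw [← hv, ← hwin]
    obtain ⟨d, hd⟩ : ∃ d : ℕ, (d : ℤ) = v₁.length + j := ⟨(v₁.length + j).toNat, by omega⟩
    obtain ⟨r, hr⟩ : ∃ r, v.length = d + l + r := ⟨v.length - d - l, by omega⟩
    rw [hr, window_add, window_add, show -(v₁.length : ℤ) + d = j by omega]
    exact ⟨_, _, rfl⟩

variable [Finite A] [TopologicalSpace A] [DiscreteTopology A]

/-- The local solutions of radius `m` form nested non-empty closed sets. They are compact since `A`
is finite and `k < K`, and a common point is a global desubstitution. -/
theorem exists_desubstitution {σ : ℕ → Substitution A} {n K : ℕ}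
    (hK : ∀ a, ((σ n).toFun a).length ≤ K) {x : ℤ → A} (hx : x ∈ levelShift σ n) :
    ∃ (y : ℤ → A) (k : ℕ), y ∈ levelShift σ (n + 1) ∧ k < ((σ n).toFun (y 0)).length ∧
      shift^[k] ((σ n).onSeq y) = x := by
  let C : ℕ → Set ((ℤ → A) × ℕ) := fun m =>
    {p | p.2 < ((σ n).toFun (p.1 0)).length} ∩
    ({p | ∀ i : ℤ, |i| ≤ m → shift^[p.2] ((σ n).onSeq p.1) i = x i} ∩
    {p | ∀ (j : ℤ) (l : ℕ), -(m : ℤ) ≤ j → j + l ≤ m → window p.1 j l ∈ preLanguage σ (n + 1)})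
  have hcl : ∀ m, IsClosed (C m) := by
    intro m
    refine (isClosed_setOf_lt_length _).inter (IsClosed.inter ?_ ?_)
    · simp only [Set.ofPred_forall]
      exact isClosed_iInter fun i => isClosed_iInter fun _ => isClosed_eq
        ((continuous_apply i).comp (σ n).continuous_shift_iterate_onSeq) continuous_const
    · simp only [Set.ofPred_forall]
      exact isClosed_iInter fun j => isClosed_iInter fun l => isClosed_iInter fun _ =>
        isClosed_iInter fun _ => IsClosed.preimage (f := Prod.fst) continuous_fst
          (isClosed_setOf_window_mem j l (preLanguage σ (n + 1)))
  have hcomp : IsCompact (C 0) := by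
    refine IsCompact.of_isClosed_subset (isCompact_univ.prod (Set.finite_Iio K).isCompact)
      (hcl 0) fun p hp => ⟨trivial, ?_⟩
    exact lt_of_lt_of_le hp.1 (hK _)
  obtain ⟨⟨y, k⟩, hp⟩ := IsCompact.nonempty_iInter_of_sequence_nonempty_isCompact_isClosed C
    (fun m p hp => ⟨hp.1, fun i hi => hp.2.1 i (by push_cast; omega),
      fun j l hj hl => hp.2.2 j l (by push_cast; omega) (by push_cast; omega)⟩)
    (fun m => by
      obtain ⟨y, k, h1, h2, h3⟩ := exists_local_desubstitution hK hx m
      exact ⟨(y, k), h1, h2, h3⟩) hcomp hcl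
  rw [Set.mem_iInter] at hp
  refine ⟨y, k, ?_, (hp 0).1, ?_⟩
  · intro j l
    exact (hp (j.natAbs + l)).2.2 j l (by omega) (by omega)
  · funext i
    exact (hp i.natAbs).2.1 i (by simp)

/-- `(y, k) ↦ T^k σ_n(y)` is continuous on a compact set and injective there by recognizability, so
its inverse is continuous: the preimage of a closed `F` is the image of a compact set. -/
theorem exists_continuousOn_desubstitution {σ : ℕ → Substitution A} {n K : ℕ}
    (hK : ∀ a, ((σ n).toFun a).length ≤ K)
    (hrec : (σ n).RecognizableIn (levelShift σ (n + 1))) :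
    ∃ g : (ℤ → A) → (ℤ → A) × ℕ, ContinuousOn g (levelShift σ n) ∧
      ∀ x ∈ levelShift σ n, (g x).1 ∈ levelShift σ (n + 1) ∧
        (g x).2 < ((σ n).toFun ((g x).1 0)).length ∧
        shift^[(g x).2] ((σ n).onSeq (g x).1) = x := by
  have hex : ∀ x : ℤ → A, ∃ p : (ℤ → A) × ℕ, x ∈ levelShift σ n →
      p.1 ∈ levelShift σ (n + 1) ∧ p.2 < ((σ n).toFun (p.1 0)).length ∧
        shift^[p.2] ((σ n).onSeq p.1) = x := by
    intro x
    by_cases hx : x ∈ levelShift σ n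
    · obtain ⟨y, k, h⟩ := exists_desubstitution hK hx
      exact ⟨(y, k), fun _ => h⟩
    · exact ⟨(x, 0), fun h => absurd h hx⟩
  choose g hg using hex
  refine ⟨g, ?_, hg⟩
  let G : Set ((ℤ → A) × ℕ) :=
    {p | p.1 ∈ levelShift σ (n + 1)} ∩ {p | p.2 < ((σ n).toFun (p.1 0)).length}
  have hG : IsCompact G :=
    IsCompact.of_isClosed_subset (isCompact_univ.prod (Set.finite_Iio K).isCompact)
      (((isClosed_levelShift σ (n + 1)).preimage continuous_fst).inter
        (isClosed_setOf_lt_length _)) fun p hp => ⟨trivial, lt_of_lt_of_le hp.2 (hK _)⟩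
  rw [continuousOn_iff_isClosed]
  intro F hF
  refine ⟨(fun p : (ℤ → A) × ℕ => shift^[p.2] ((σ n).onSeq p.1)) '' (G ∩ F),
    ((hG.inter_right hF).image (σ n).continuous_shift_iterate_onSeq).isClosed, ?_⟩
  ext x
  constructor
  · rintro ⟨hF', hx⟩
    exact ⟨⟨g x, ⟨⟨(hg x hx).1, (hg x hx).2.1⟩, hF'⟩, (hg x hx).2.2⟩, hx⟩
  · rintro ⟨⟨p, ⟨hpG, hpF⟩, hpx⟩, hx⟩
    obtain ⟨h1, h2, h3⟩ := hg x hx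
    have := hrec (g x).1 p.1 (g x).2 p.2 h1 hpG.1 h2 hpG.2 (h3.trans hpx.symm)
    have : g x = p := Prod.ext this.2 this.1
    exact ⟨by rw [Set.mem_preimage, this]; exact hpF, hx⟩

end SAdic

/-! ### Towers and the eigenfunction. -/

namespace SAdic

variable {A : Type*}

/-- The length of `σ_{[0,n)}(w)`. -/
def wordHeight (σ : ℕ → Substitution A) (n : ℕ) (w : List A) : ℕ := (w.map (height σ n)).sum

theorem height_succ (σ : ℕ → Substitution A) (n : ℕ) (a : A) :
    height σ (n + 1) a = wordHeight σ n ((σ n).toFun a) := by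
  rw [height, block, List.length_flatMap, zero_add]
  rfl

theorem norm_pow_wordHeight_sub_one_le [Fintype A] (σ : ℕ → Substitution A) {l : ℂ}
    (hl : ‖l‖ = 1) (n : ℕ) (w : List A) :
    ‖l ^ wordHeight σ n w - 1‖ ≤ w.length * ∑ a, ‖l ^ height σ n a - 1‖ := by
  induction w with
  | nil => simp [wordHeight]
  | cons a w ih =>
    have h : wordHeight σ n (a :: w) = height σ n a + wordHeight σ n w := by simp [wordHeight]
    have h1 : l ^ wordHeight σ n (a :: w) - 1 =
        l ^ height σ n a * (l ^ wordHeight σ n w - 1) + (l ^ height σ n a - 1) := by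
      rw [h, pow_add]; ring
    have h2 : ‖l ^ height σ n a - 1‖ ≤ ∑ a, ‖l ^ height σ n a - 1‖ :=
      Finset.single_le_sum (f := fun a => ‖l ^ height σ n a - 1‖) (fun _ _ => norm_nonneg _)
        (Finset.mem_univ a)
    rw [h1]
    refine (norm_add_le _ _).trans ?_
    rw [norm_mul, norm_pow, hl, one_pow, one_mul, List.length_cons]
    push_cast
    linarith

/-- The point of level `n` obtained from `x` by iterating the desubstitution maps `g`. -/
def levelPoint (g : ℕ → (ℤ → A) → (ℤ → A) × ℕ) (x : ℤ → A) : ℕ → (ℤ → A)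
  | 0 => x
  | n + 1 => (g n (levelPoint g x n)).1

/-- The position of the origin of `x` in the level-`n` tower that contains it. -/
def entrance (σ : ℕ → Substitution A) (g : ℕ → (ℤ → A) → (ℤ → A) × ℕ) (x : ℤ → A) : ℕ → ℕ
  | 0 => 0
  | n + 1 => entrance σ g x n + wordHeight σ n
      (((σ n).toFun (levelPoint g x (n + 1) 0)).take (g n (levelPoint g x n)).2)

/-- `g n x` is a representation of `x` as a shifted image under `σ_n`, for `x` of level `n`. -/
def IsDesubstitution (σ : ℕ → Substitution A) (g : ℕ → (ℤ → A) → (ℤ → A) × ℕ) : Prop :=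
  ∀ n, ∀ x ∈ levelShift σ n, (g n x).1 ∈ levelShift σ (n + 1) ∧
    (g n x).2 < ((σ n).toFun ((g n x).1 0)).length ∧
    shift^[(g n x).2] ((σ n).onSeq (g n x).1) = x

theorem IsDesubstitution.levelPoint_mem {σ : ℕ → Substitution A}
    {g : ℕ → (ℤ → A) → (ℤ → A) × ℕ} (hg : IsDesubstitution σ g) {x : ℤ → A}
    (hx : x ∈ levelShift σ 0) (n : ℕ) : levelPoint g x n ∈ levelShift σ n := by
  induction n with
  | zero => exact hx
  | succ n ih => exact (hg n _ ih).1

/-- Recognizability leaves two cases: the shift advances within the image of the current letter, or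
it leaves that image and enters the next one at position 0. -/
theorem IsDesubstitution.shift_eq {σ : ℕ → Substitution A} {g : ℕ → (ℤ → A) → (ℤ → A) × ℕ}
    (hg : IsDesubstitution σ g) (hrec : Recognizable σ) {n : ℕ} {z : ℤ → A}
    (hz : z ∈ levelShift σ n) :
    ((g n z).2 + 1 < ((σ n).toFun ((g n z).1 0)).length ∧
      g n (shift z) = ((g n z).1, (g n z).2 + 1)) ∨
    ((g n z).2 + 1 = ((σ n).toFun ((g n z).1 0)).length ∧
      g n (shift z) = (shift (g n z).1, 0)) := by
  obtain ⟨h1, h2, h3⟩ := hg n z hz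
  obtain ⟨h1', h2', h3'⟩ := hg n _ (shift_mem_levelShift hz)
  by_cases h : (g n z).2 + 1 < ((σ n).toFun ((g n z).1 0)).length
  · left
    refine ⟨h, ?_⟩
    have := hrec n _ _ _ ((g n z).2 + 1) h1' h1 h2' h
      (h3'.trans (by rw [Function.iterate_succ_apply', h3]))
    exact Prod.ext this.2 this.1
  · right
    have h4 : (g n z).2 + 1 = ((σ n).toFun ((g n z).1 0)).length := by omega
    refine ⟨h4, ?_⟩
    have := hrec n _ _ _ 0 h1' (shift_mem_levelShift h1) h2' ((σ n).toFun_length_pos _)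
      (h3'.trans (by
        rw [Function.iterate_zero_apply, Substitution.onSeq_shift, ← h4,
          Function.iterate_succ_apply', h3]))
    exact Prod.ext this.2 this.1

theorem IsDesubstitution.apply_zero {σ : ℕ → Substitution A} {g : ℕ → (ℤ → A) → (ℤ → A) × ℕ}
    (hg : IsDesubstitution σ g) {n : ℕ} {z : ℤ → A} (hz : z ∈ levelShift σ n) :
    z 0 = ((σ n).toFun ((g n z).1 0))[(g n z).2]'(hg n z hz).2.1 := by
  obtain ⟨h1, h2, h3⟩ := hg n z hz
  have := congrFun h3 0
  rw [shift_iterate_apply, zero_add, (σ n).onSeq_ofNat _ _ h2] at this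
  exact this.symm

/-- An odometer with carry: the shift climbs one floor in the level-`n` tower, or drops from the top
floor to the base of the next tower. -/
theorem IsDesubstitution.entrance_shift {σ : ℕ → Substitution A}
    {g : ℕ → (ℤ → A) → (ℤ → A) × ℕ} (hg : IsDesubstitution σ g) (hrec : Recognizable σ)
    {x : ℤ → A} (hx : x ∈ levelShift σ 0) (n : ℕ) :
    (levelPoint g (shift x) n = levelPoint g x n ∧
      entrance σ g (shift x) n = entrance σ g x n + 1) ∨
    (levelPoint g (shift x) n = shift (levelPoint g x n) ∧
      entrance σ g (shift x) n + height σ n (levelPoint g x n 0) = entrance σ g x n + 1) := by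
  induction n with
  | zero => exact Or.inr ⟨rfl, rfl⟩
  | succ n ih =>
    rcases ih with ⟨h1, h2⟩ | ⟨h1, h2⟩
    · left
      simp only [levelPoint, entrance, h1, h2, true_and]
      omega
    · have hz := hg.levelPoint_mem hx n
      have h0 := hg.apply_zero hz
      have hlt := (hg n _ hz).2.1
      have htake : wordHeight σ n (((σ n).toFun ((g n (levelPoint g x n)).1 0)).take
          ((g n (levelPoint g x n)).2 + 1)) =
          wordHeight σ n (((σ n).toFun ((g n (levelPoint g x n)).1 0)).take
            (g n (levelPoint g x n)).2) + height σ n (levelPoint g x n 0) := by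
        rw [List.take_succ_eq_append_getElem hlt, ← h0]
        simp [wordHeight]
      rcases hg.shift_eq hrec hz with ⟨h3, h4⟩ | ⟨h3, h4⟩
      · left
        simp only [levelPoint, entrance, h1, h4, htake, true_and]
        omega
      · right
        rw [h3, List.take_length, ← height_succ] at htake
        simp only [levelPoint, entrance, h1, h4, true_and, htake, List.take_zero]
        simp only [wordHeight, List.map_nil, List.sum_nil] at htake ⊢
        omega

theorem continuousOn_entrance [TopologicalSpace A] [DiscreteTopology A]
    {σ : ℕ → Substitution A} {g : ℕ → (ℤ → A) → (ℤ → A) × ℕ} (hg : IsDesubstitution σ g)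
    (hgc : ∀ n, ContinuousOn (g n) (levelShift σ n)) (n : ℕ) :
    ContinuousOn (fun x => levelPoint g x n) (levelShift σ 0) ∧
      ContinuousOn (fun x => entrance σ g x n) (levelShift σ 0) := by
  induction n with
  | zero => exact ⟨continuousOn_id, continuousOn_const⟩
  | succ n ih =>
    have h : ContinuousOn (fun x => g n (levelPoint g x n)) (levelShift σ 0) :=
      (hgc n).comp ih.1 fun x hx => hg.levelPoint_mem hx n
    refine ⟨h.fst, ih.2.add ?_⟩
    let F : A × ℕ → ℕ := fun q => wordHeight σ n (((σ n).toFun q.1).take q.2)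
    have hF : Continuous F := continuous_of_discreteTopology
    have h0 : Continuous fun y : ℤ → A => y 0 := continuous_apply 0
    exact hF.comp_continuousOn ((h0.comp_continuousOn h.fst).prodMk h.snd)

/-- Consecutive entrances differ by the height of a prefix of some `σ_n(b)`, so `λ^{r_n}` converges
uniformly, with increments at most `K ∑ |λ^{h_n(a)} - 1|`. The limit has modulus 1. -/
theorem isContinuousEigenvalue_of_summable [Fintype A] [TopologicalSpace A] [DiscreteTopology A]
    {σ : ℕ → Substitution A} {K : ℕ} (hK : ∀ n a, ((σ n).toFun a).length ≤ K)
    (hrec : Recognizable σ) (hne : (levelShift σ 0).Nonempty) {l : ℂ} (hl : ‖l‖ = 1)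
    (hsum : ∀ a, Summable fun n => ‖l ^ height σ n a - 1‖) :
    IsContinuousEigenvalue (levelShift σ 0) l := by
  choose g hgc hg using fun n => exists_continuousOn_desubstitution (hK n) (hrec n)
  have hg : IsDesubstitution σ g := hg
  set F : ℕ → (ℤ → A) → ℂ := fun n x => l ^ entrance σ g x n with hF
  set c : ℕ → ℝ := fun n => K * ∑ a, ‖l ^ height σ n a - 1‖ with hc
  have hcs : Summable c := (summable_sum fun a _ => hsum a).mul_left _
  have hbound : ∀ n x, ‖F (n + 1) x - F n x‖ ≤ c n := by
    intro n x
    have h : F (n + 1) x - F n x = l ^ entrance σ g x n * (l ^ wordHeight σ n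
      (((σ n).toFun (levelPoint g x (n + 1) 0)).take (g n (levelPoint g x n)).2) - 1) := by
      simp only [hF, entrance, pow_add]; ring
    rw [h, norm_mul, norm_pow, hl, one_pow, one_mul]
    refine (norm_pow_wordHeight_sub_one_le σ hl n _).trans ?_
    refine mul_le_mul_of_nonneg_right ?_ (Finset.sum_nonneg fun _ _ => norm_nonneg _)
    rw [List.length_take]
    exact_mod_cast (min_le_right _ _).trans (hK n _)
  have hlim : ∀ x, Tendsto (fun n => F n x) atTop (𝓝 (1 + ∑' n, (F (n + 1) x - F n x))) := by
    intro x
    have h := (Summable.of_norm_bounded hcs fun n => hbound n x).hasSum.tendsto_sum_nat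
    simp only [Finset.sum_range_sub fun n => F n x] at h
    have h' := h.const_add (F 0 x)
    simpa [hF, entrance] using h'
  have hcont : ∀ n, ContinuousOn (F n) (levelShift σ 0) := by
    intro n
    have h : Continuous fun m : ℕ => l ^ m := continuous_of_discreteTopology
    exact h.comp_continuousOn (continuousOn_entrance hg hgc n).2
  refine ⟨fun x => 1 + ∑' n, (F (n + 1) x - F n x), ?_, ?_, ?_⟩
  · exact continuousOn_const.add (continuousOn_tsum (fun n => (hcont (n + 1)).sub (hcont n)) hcs
      fun n x _ => hbound n x)
  · obtain ⟨x, hx⟩ := hne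
    refine ⟨x, hx, fun h0 => ?_⟩
    have h := (hlim x).norm
    have h1 : ∀ n, ‖F n x‖ = 1 := fun n => by simp [hF, hl]
    simp only [h1, h0, norm_zero] at h
    exact one_ne_zero (tendsto_nhds_unique tendsto_const_nhds h)
  · intro x hx
    have h1 := (hlim (shift x)).sub ((hlim x).const_mul l)
    -- The difference vanishes unless `x` is on the top floor, where its modulus is `|λ^{h_n(a)} -
    -- 1|` for the letter `a` of that tower.
    have h2 : Tendsto (fun n => F n (shift x) - l * F n x) atTop (𝓝 0) := by
      have h3 : Tendsto (fun n => ∑ a, ‖l ^ height σ n a - 1‖) atTop (𝓝 0) := by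
        simpa using tendsto_finsetSum Finset.univ fun a _ => (hsum a).tendsto_atTop_zero
      refine squeeze_zero_norm (fun n => ?_) h3
      rcases hg.entrance_shift hrec hx n with ⟨-, h⟩ | ⟨-, h⟩
      · simp only [hF, h, pow_succ']
        simpa using Finset.sum_nonneg fun _ _ => norm_nonneg _
      · have h4 : l * F n x = F n (shift x) * l ^ height σ n (levelPoint g x n 0) := by
          simp only [hF]
          rw [← pow_succ', ← h, pow_add]
        rw [h4, show F n (shift x) - F n (shift x) * l ^ height σ n (levelPoint g x n 0) =
          -(F n (shift x) * (l ^ height σ n (levelPoint g x n 0) - 1)) by ring, norm_neg, norm_mul,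
          show ‖F n (shift x)‖ = 1 by simp [hF, hl], one_mul]
        exact Finset.single_le_sum (f := fun a => ‖l ^ height σ n a - 1‖)
          (fun _ _ => norm_nonneg _) (Finset.mem_univ _)
    exact sub_eq_zero.1 (tendsto_nhds_unique h1 h2)

end SAdic

/-! ### Weights of words and incidence matrices. -/

namespace SAdic

variable {A : Type*}

theorem Finitary.exists_length_le [Fintype A] {σ : ℕ → Substitution A} (hfin : Finitary σ) :
    ∃ K, ∀ n a, ((σ n).toFun a).length ≤ K := by
  obtain ⟨K, hK⟩ := (Set.Finite.image
    (fun s : Substitution A => ∑ a, (s.toFun a).length) hfin).bddAbove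
  refine ⟨K, fun n a => le_trans ?_ (hK ⟨σ n, ⟨n, rfl⟩, rfl⟩)⟩
  exact Finset.single_le_sum (f := fun a => ((σ n).toFun a).length) (fun _ _ => Nat.zero_le _)
    (Finset.mem_univ a)

section Weight

/-- The sum of the values of `v` at the letters of `w`. -/
def weight (v : A → ℝ) (w : List A) : ℝ := (w.map v).sum

@[simp] theorem weight_nil (v : A → ℝ) : weight v [] = 0 := rfl

@[simp] theorem weight_cons (v : A → ℝ) (a : A) (w : List A) :
    weight v (a :: w) = v a + weight v w := by simp [weight]

@[simp] theorem weight_append (v : A → ℝ) (w w' : List A) :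
    weight v (w ++ w') = weight v w + weight v w' := by simp [weight]

theorem weight_eq_sum_count [Fintype A] [DecidableEq A] (v : A → ℝ) (w : List A) :
    weight v w = ∑ i, v i * (w.count i : ℝ) := by
  induction w with
  | nil => simp
  | cons a w ih =>
    simp [ih, List.count_cons, mul_add, Finset.sum_add_distrib, add_comm]

theorem abs_weight_le {v : A → ℝ} {C : ℝ} (hC : ∀ a, |v a| ≤ C) (w : List A) :
    |weight v w| ≤ C * w.length := by
  induction w with
  | nil => simp
  | cons a w ih =>
    rw [weight_cons, List.length_cons]
    push_cast
    have := hC a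
    have := abs_add_le (v a) (weight v w)
    linarith

/-- A prefix consists of whole blocks, each of weight at most `δ` and so at most `δ` times its
length, followed by one partial block of length at most `H`. -/
theorem abs_weight_le_of_prefix {v : A → ℝ} {C δ : ℝ} {H : ℕ} {B : A → List A}
    (hC : ∀ a, |v a| ≤ C) (hB : ∀ b, B b ≠ []) (hH : ∀ b, (B b).length ≤ H)
    (hδ : ∀ b, |weight v (B b)| ≤ δ) (hC0 : 0 ≤ C) (hδ0 : 0 ≤ δ) (l w : List A)
    (h : w <+: l.flatMap B) :
    |weight v w| ≤ δ * w.length + C * H := by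
  induction l generalizing w with
  | nil =>
    obtain rfl : w = [] := by simpa using h
    simp only [weight_nil, abs_zero, List.length_nil]
    positivity
  | cons b l ih =>
    rw [List.flatMap_cons] at h
    rcases List.prefix_or_prefix_of_prefix h (List.prefix_append (B b) _) with h' | ⟨t, rfl⟩
    · have h1 : (w.length : ℝ) ≤ H := by exact_mod_cast h'.length_le.trans (hH b)
      have h2 := mul_le_mul_of_nonneg_left h1 hC0
      have h3 := abs_weight_le hC w
      have h4 : 0 ≤ δ * w.length := by positivity
      linarith
    · have h1 : (1 : ℝ) ≤ (B b).length := by exact_mod_cast List.length_pos_of_ne_nil (hB b)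
      have h2 := mul_le_mul_of_nonneg_left h1 hδ0
      have h3 := abs_add_le (weight v (B b)) (weight v t)
      have h4 := hδ b
      have h5 := ih t ((List.prefix_append_right_inj _).1 h)
      rw [weight_append, List.length_append]
      push_cast
      linarith

/-- There may now be a partial block at both ends, whence the factor 2. -/
theorem abs_weight_le_of_infix {v : A → ℝ} {C δ : ℝ} {H : ℕ} {B : A → List A}
    (hC : ∀ a, |v a| ≤ C) (hB : ∀ b, B b ≠ []) (hH : ∀ b, (B b).length ≤ H)
    (hδ : ∀ b, |weight v (B b)| ≤ δ) (hC0 : 0 ≤ C) (hδ0 : 0 ≤ δ) (l w : List A)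
    (h : w <:+: l.flatMap B) :
    |weight v w| ≤ δ * w.length + 2 * (C * H) := by
  have hCH : 0 ≤ C * H := by positivity
  have hshort : ∀ b w, w <:+: B b → |weight v w| ≤ C * H := by
    intro b w h
    have h1 : (w.length : ℝ) ≤ H := by exact_mod_cast h.length_le.trans (hH b)
    exact (abs_weight_le hC w).trans (mul_le_mul_of_nonneg_left h1 hC0)
  induction l with
  | nil =>
    obtain rfl : w = [] := by simpa using h
    simp only [weight_nil, abs_zero, List.length_nil]
    positivity
  | cons b l ih =>
    rw [List.flatMap_cons, List.infix_append_iff] at h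
    rcases h with h | h | ⟨p, q, rfl, hp, hq⟩
    · have h1 := hshort b w h
      have h4 : 0 ≤ δ * w.length := by positivity
      linarith
    · exact ih h
    · have h1 := hshort b p hp.isInfix
      have h2 := abs_weight_le_of_prefix hC hB hH hδ hC0 hδ0 l q hq
      have h3 := abs_add_le (weight v p) (weight v q)
      have h4 : 0 ≤ δ * p.length := by positivity
      rw [weight_append, List.length_append]
      push_cast
      linarith

theorem weight_window (v : A → ℝ) (x : ℤ → A) (k : ℤ) (l : ℕ) :
    weight v (window x k l) = ∑ i ∈ Finset.range l, v (x (k + i)) := by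
  induction l with
  | zero => simp
  | succ l ih => rw [window_succ, weight_append, ih, Finset.sum_range_succ]; simp

end Weight

theorem block_ne_nil (σ : ℕ → Substitution A) (n k : ℕ) (a : A) : block σ n k a ≠ [] := by
  induction k generalizing a with
  | zero => simp [block]
  | succ k ih =>
    obtain ⟨b, hb⟩ := List.exists_mem_of_ne_nil _ ((σ (n + k)).ne_nil a)
    rw [block, Ne, List.flatMap_eq_nil_iff]
    exact fun h => ih b (h b hb)

variable [Fintype A] [DecidableEq A]

theorem incidenceProd_succ (σ : ℕ → Substitution A) (n : ℕ) :
    incidenceProd σ 0 (n + 1) = incidenceProd σ 0 n * (σ n).incidence := by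
  simp [incidenceProd, List.range_succ]

open scoped Matrix in
theorem vecMul_incidence (s : Substitution A) (v : A → ℝ) (a : A) :
    (v ᵥ* s.incidence) a = weight v (s.toFun a) := by
  simp [weight_eq_sum_count, Matrix.vecMul, dotProduct, Substitution.incidence]

open scoped Matrix in
theorem vecMul_incidenceProd (σ : ℕ → Substitution A) (v : A → ℝ) (n : ℕ) (a : A) :
    (v ᵥ* incidenceProd σ 0 n) a = weight v (block σ 0 n a) := by
  induction n generalizing a with
  | zero => simp [incidenceProd, block]
  | succ n ih =>
    rw [incidenceProd_succ, ← Matrix.vecMul_vecMul, vecMul_incidence, block, zero_add]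
    generalize (σ n).toFun a = w
    induction w with
    | nil => simp
    | cons b w ihw => rw [weight_cons, ihw, List.flatMap_cons, weight_append, ih]

theorem incidenceProd_apply (σ : ℕ → Substitution A) (n : ℕ) (i a : A) :
    incidenceProd σ 0 n i a = ((block σ 0 n a).count i : ℝ) := by
  have h := vecMul_incidenceProd σ (Pi.single i 1) n a
  rw [weight_eq_sum_count] at h
  simpa [Matrix.single_vecMul, Pi.single_apply] using h

theorem det_incidenceProd_ne_zero {σ : ℕ → Substitution A}
    (hinv : ∀ n, (σ n).incidence.det ≠ 0) (n : ℕ) : (incidenceProd σ 0 n).det ≠ 0 := by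
  induction n with
  | zero => simp [incidenceProd]
  | succ n ih =>
    rw [incidenceProd_succ, Matrix.det_mul]
    exact mul_ne_zero ih (hinv n)

theorem Unimodular.det_incidenceProd {σ : ℕ → Substitution A} (h : Unimodular σ) (n : ℕ) :
    (incidenceProd σ 0 n).det * (incidenceProd σ 0 n).det = 1 := by
  induction n with
  | zero => simp [incidenceProd]
  | succ n ih =>
    rw [incidenceProd_succ, Matrix.det_mul, mul_mul_mul_comm, ih]
    rcases h n with h | h <;> simp [h]

open scoped Matrix in
-- Cramer's rule for the integer matrix `N` of counts: `q = w · adj(N) / det N`. In the unimodular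
-- case `det N` is its own inverse, so `q` is integral.
theorem exists_rat_vecMul_eq {σ : ℕ → Substitution A} (hinv : ∀ n, (σ n).incidence.det ≠ 0)
    (n : ℕ) (w : A → ℤ) :
    ∃ q : A → ℚ, (fun i => (q i : ℝ)) ᵥ* incidenceProd σ 0 n = (fun a => (w a : ℝ)) ∧
      (Unimodular σ → ∃ m : A → ℤ, ∀ i, q i = m i) := by
  let N : Matrix A A ℤ := Matrix.of fun i a => ((block σ 0 n a).count i : ℤ)
  have hN : incidenceProd σ 0 n = N.map (Int.castRingHom ℝ) := by
    ext i a
    simp [N, incidenceProd_apply]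
  have hdet : (incidenceProd σ 0 n).det = (N.det : ℝ) := by
    rw [hN, ← RingHom.mapMatrix_apply, ← RingHom.map_det]
    rfl
  have hdet0 : (N.det : ℝ) ≠ 0 := hdet ▸ det_incidenceProd_ne_zero hinv n
  have h : (w ᵥ* N.adjugate) ᵥ* N = N.det • w := by
    rw [Matrix.vecMul_vecMul, Matrix.adjugate_mul, Matrix.vecMul_smul, Matrix.vecMul_one]
  generalize N.det = d at hdet hdet0 h
  generalize w ᵥ* N.adjugate = z at h
  refine ⟨fun i => (z i : ℚ) * (d : ℚ)⁻¹, ?_, fun hu => ⟨fun i => z i * d, fun i => ?_⟩⟩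
  · funext a
    have ha : ∑ i, z i * N i a = d * w a := congrFun h a
    have ha' : ∑ i, (z i : ℝ) * (N i a : ℝ) = d * w a := by exact_mod_cast ha
    rw [hN, ← mul_right_inj' hdet0, ← ha']
    simp only [Matrix.vecMul, dotProduct, Matrix.map_apply, eq_intCast, Finset.mul_sum]
    refine Finset.sum_congr rfl fun i _ => ?_
    push_cast
    field_simp
  · have h1 := hu.det_incidenceProd n
    rw [hdet] at h1
    have h2 : (d : ℚ) * d = 1 := by exact_mod_cast h1
    rw [inv_eq_of_mul_eq_one_left h2]
    push_cast
    rfl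

end SAdic

/-! ### Strong convergence and letter frequencies. -/

namespace SAdic

variable {A : Type*}

theorem weight_const_sub (c : ℝ) (w : A → ℝ) (l : List A) :
    weight (fun i => c - w i) l = c * l.length - weight w l := by
  induction l with
  | nil => simp
  | cons a l ih => simp only [weight_cons, ih, List.length_cons]; push_cast; ring

theorem one_le_height (σ : ℕ → Substitution A) (n : ℕ) (a : A) : 1 ≤ height σ n a :=
  List.length_pos_of_ne_nil (block_ne_nil σ 0 n a)

theorem IsInvariantProbability.integral_apply [MeasurableSpace A]
    [DiscreteMeasurableSpace A] {X : Set (ℤ → A)} {μ : Measure (ℤ → A)}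
    (hμ : IsInvariantProbability X μ) (v : A → ℝ) (i : ℕ) :
    ∫ x, v (x i) ∂μ = ∫ x, v (x 0) ∂μ := by
  have h := hμ.invariant.iterate i
  have hm : Measurable fun x : ℤ → A => v (x 0) :=
    (Measurable.of_discrete (f := v)).comp (measurable_pi_apply 0)
  have h' := integral_map (μ := μ) h.measurable.aemeasurable (f := fun x : ℤ → A => v (x 0))
    hm.aestronglyMeasurable
  rw [h.map_eq] at h'
  simp only [shift_iterate_apply, zero_add] at h'
  exact h'.symm

variable [Fintype A] [DecidableEq A]

/-- Since `v` is orthogonal to `u`, subtracting `r • u` from the column does not change its pairing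
with `v`; Cauchy–Schwarz then applies for every `r`. -/
theorem abs_weight_block_le_distToLine {σ : ℕ → Substitution A} {u : EuclideanSpace ℝ A}
    {v : A → ℝ} (hv : ∑ i, v i * u i = 0) (n : ℕ) (a : A) :
    |weight v (block σ 0 n a)| ≤ ‖(WithLp.toLp 2 v : EuclideanSpace ℝ A)‖ * distToLine σ u n a := by
  set V : EuclideanSpace ℝ A := WithLp.toLp 2 v with hV
  have hinner : ∀ x : EuclideanSpace ℝ A, inner ℝ V x = ∑ i, v i * x i := by
    intro x
    simp [hV, PiLp.inner_apply, mul_comm]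
  have hw : weight v (block σ 0 n a) = inner ℝ V (column σ n a) := by
    rw [hinner, weight_eq_sum_count]
    simp [column, incidenceProd_apply]
  have hle : ∀ r : ℝ, |weight v (block σ 0 n a)| ≤ ‖V‖ * dist (column σ n a) (r • u) := by
    intro r
    have h : weight v (block σ 0 n a) = inner ℝ V (column σ n a - r • u) := by
      rw [inner_sub_right, inner_smul_right, hinner u, hv, hw]
      ring
    rw [h, dist_eq_norm]
    exact abs_real_inner_le_norm _ _
  rcases (norm_nonneg V).eq_or_lt with h0 | h0
  · have := hle 0
    rw [← h0, zero_mul] at this ⊢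
    exact this
  · have hne : {v : EuclideanSpace ℝ A | ∃ r : ℝ, v = r • u}.Nonempty := ⟨_, 0, rfl⟩
    rw [← div_le_iff₀' h0, distToLine, Metric.le_infDist hne]
    rintro y ⟨r, rfl⟩
    rw [div_le_iff₀' h0]
    exact hle r

theorem StronglyConvergent.tendsto_distToLine {σ : ℕ → Substitution A} {u : EuclideanSpace ℝ A}
    (hconv : StronglyConvergent σ u) (a : A) :
    Tendsto (fun n => distToLine σ u n a) atTop (𝓝 0) := by
  refine squeeze_zero (fun n => Metric.infDist_nonneg) (fun n => ?_) (hconv.2.2 a)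
  exact Metric.infDist_le_infDist_of_subset (fun v ⟨r, _, hr⟩ => ⟨r, hr⟩) ⟨_, 1, one_pos, rfl⟩

theorem StronglyConvergent.tendsto_weight {σ : ℕ → Substitution A} {u : EuclideanSpace ℝ A}
    (hconv : StronglyConvergent σ u) {v : A → ℝ} (hv : ∑ i, v i * u i = 0) (a : A) :
    Tendsto (fun n => weight v (block σ 0 n a)) atTop (𝓝 0) := by
  refine squeeze_zero_norm (fun n => abs_weight_block_le_distToLine hv n a) ?_
  simpa using (hconv.tendsto_distToLine a).const_mul _

/-- With `c = ∑ v_i u_i`, the vector `c·1 - v` is orthogonal to `u`, so its weights tend to 0.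
Adding those of `v` gives `c h_n(a) → 0`, while `h_n(a) ≥ 1`. -/
theorem StronglyConvergent.sum_eq_zero_of_tendsto [Nonempty A] {σ : ℕ → Substitution A}
    {u : EuclideanSpace ℝ A} (hconv : StronglyConvergent σ u) {v : A → ℝ}
    (hv : ∀ a, Tendsto (fun n => weight v (block σ 0 n a)) atTop (𝓝 0)) :
    ∑ i, v i * u i = 0 := by
  set c := ∑ i, v i * u i with hc
  obtain ⟨a⟩ := ‹Nonempty A›
  have h0 : ∑ i, (c - v i) * u i = 0 := by
    simp only [sub_mul, Finset.sum_sub_distrib, ← Finset.mul_sum, hconv.2.1, ← hc]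
    ring
  have h1 := (hconv.tendsto_weight h0 a).add (hv a)
  simp only [weight_const_sub, sub_add_cancel, add_zero] at h1
  have h2 : Tendsto (fun _ : ℕ => |c|) atTop (𝓝 0) := by
    refine squeeze_zero (fun _ => abs_nonneg c) (fun n => ?_) (by simpa using h1.abs)
    have h3 : (1 : ℝ) ≤ (block σ 0 n a).length := by exact_mod_cast one_le_height σ n a
    exact le_mul_of_one_le_right (abs_nonneg c) h3
  exact abs_eq_zero.1 (tendsto_nhds_unique tendsto_const_nhds h2)

section Measure

/-- Fix a level `n` at which every block has weight below `δ`. Words from later levels are cut into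
level-`n` blocks, and words from earlier levels have bounded length. -/
theorem exists_abs_weight_le_of_mem_preLanguage {σ : ℕ → Substitution A}
    {u : EuclideanSpace ℝ A} (hconv : StronglyConvergent σ u) {v : A → ℝ}
    (hv : ∑ i, v i * u i = 0) {δ : ℝ} (hδ : 0 < δ) :
    ∃ C : ℝ, ∀ w ∈ preLanguage σ 0, |weight v w| ≤ δ * w.length + C := by
  have hev : ∀ᶠ n in atTop, ∀ b, |weight v (block σ 0 n b)| < δ := by
    rw [Filter.eventually_all]
    intro b
    have h := (hconv.tendsto_weight hv b).abs
    rw [abs_zero] at h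
    exact h.eventually_lt_const hδ
  obtain ⟨n, hn⟩ := hev.exists
  have hC : ∀ a, |v a| ≤ ∑ b, |v b| := fun a =>
    Finset.single_le_sum (f := fun b => |v b|) (fun _ _ => abs_nonneg _) (Finset.mem_univ a)
  have hC0 : 0 ≤ ∑ b, |v b| := Finset.sum_nonneg fun _ _ => abs_nonneg _
  set C := ∑ b, |v b| with hCdef
  set H := ∑ m ∈ Finset.range (n + 1), ∑ b, height σ m b with hH
  have hHle : ∀ m ≤ n, ∀ b, (block σ 0 m b).length ≤ H := by
    intro m hm b
    calc height σ m b ≤ ∑ b, height σ m b :=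
          Finset.single_le_sum (f := fun b => height σ m b) (fun _ _ => Nat.zero_le _)
            (Finset.mem_univ b)
      _ ≤ H := Finset.single_le_sum (f := fun m => ∑ b, height σ m b) (fun _ _ => Nat.zero_le _)
            (Finset.mem_range.2 (Nat.lt_succ_of_le hm))
  refine ⟨2 * (C * H), ?_⟩
  rintro w ⟨a, k, -, hw⟩
  rcases le_total k n with hk | hk
  · have h1 : (w.length : ℝ) ≤ H := by exact_mod_cast hw.length_le.trans (hHle k hk a)
    have h2 := mul_le_mul_of_nonneg_left h1 hC0
    have h3 := abs_weight_le hC w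
    have h4 : 0 ≤ C * H := by positivity
    have h5 : 0 ≤ δ * w.length := by positivity
    linarith
  · obtain ⟨m, rfl⟩ := Nat.exists_eq_add_of_le hk
    rw [block_add] at hw
    exact abs_weight_le_of_infix hC (block_ne_nil σ 0 n) (hHle n le_rfl) (fun b => (hn b).le)
      hC0 hδ.le _ w hw

variable [MeasurableSpace A] [DiscreteMeasurableSpace A]

/-- By invariance the weight of a window of length `L` has integral `L I`. The pointwise bound
`|I|/2 · L + C` contradicts this for large `L` unless `I = 0`. -/
theorem IsInvariantProbability.integral_eq_zero {σ : ℕ → Substitution A}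
    {u : EuclideanSpace ℝ A} (hconv : StronglyConvergent σ u) {μ : Measure (ℤ → A)}
    (hμ : IsInvariantProbability (levelShift σ 0) μ) {v : A → ℝ} (hv : ∑ i, v i * u i = 0) :
    ∫ x, v (x 0) ∂μ = 0 := by
  have := hμ.isProbability
  by_contra hne
  have hI := abs_pos.2 hne
  set I := ∫ x, v (x 0) ∂μ with hIdef
  obtain ⟨C, hC⟩ := exists_abs_weight_le_of_mem_preLanguage hconv hv (half_pos hI)
  obtain ⟨L, hL⟩ := exists_nat_gt (C / (|I| / 2))
  rw [div_lt_iff₀ (half_pos hI)] at hL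
  have hint : ∀ i : ℕ, Integrable (fun x : ℤ → A => v (x i)) μ := by
    intro i
    have hm : Measurable fun x : ℤ → A => v (x i) :=
      (Measurable.of_discrete (f := v)).comp (measurable_pi_apply _)
    refine Integrable.of_bound hm.aestronglyMeasurable (∑ b, |v b|) (ae_of_all _ fun x => ?_)
    exact Finset.single_le_sum (f := fun b => |v b|) (fun _ _ => abs_nonneg _)
      (Finset.mem_univ (x i))
  have h1 : ∫ x, weight v (window x 0 L) ∂μ = L * I := by
    simp only [weight_window, zero_add]
    rw [integral_finsetSum _ fun i _ => hint i]
    simp [hμ.integral_apply, hIdef]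
  have h2 : ‖∫ x, weight v (window x 0 L) ∂μ‖ ≤ |I| / 2 * L + C := by
    have h := norm_integral_le_of_norm_le_const (μ := μ) (C := |I| / 2 * L + C)
      (f := fun x => weight v (window x 0 L)) (by
        filter_upwards [hμ.carried] with x hx
        simpa using hC _ (hx 0 L))
    simpa using h
  rw [h1, Real.norm_eq_abs, abs_mul, Nat.abs_cast] at h2
  linarith

/-- Apply the vanishing of the integral to the indicator of `a` minus `u_a`, which is orthogonal to
`u` because `∑ u_i = 1`. -/
theorem IsInvariantProbability.letterMeasure_eq {σ : ℕ → Substitution A}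
    {u : EuclideanSpace ℝ A} (hconv : StronglyConvergent σ u) {μ : Measure (ℤ → A)}
    (hμ : IsInvariantProbability (levelShift σ 0) μ) (a : A) : letterMeasure μ a = u a := by
  have := hμ.isProbability
  have hv : ∑ i, ((if i = a then 1 else 0) - u a) * u i = 0 := by
    simp [sub_mul, Finset.sum_sub_distrib, ← Finset.mul_sum, hconv.2.1]
  have h := hμ.integral_eq_zero hconv hv
  have hs : MeasurableSet {x : ℤ → A | x 0 = a} :=
    MeasurableSet.preimage (MeasurableSet.of_discrete (s := {a}))
      (measurable_pi_apply (X := fun _ : ℤ => A) 0)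
  have hind : (fun x : ℤ → A => if x 0 = a then (1 : ℝ) else 0) =
      Set.indicator {x : ℤ → A | x 0 = a} 1 := by
    ext x
    simp [Set.indicator_apply]
  rw [integral_sub (by rw [hind]; exact (integrable_const 1).indicator hs) (integrable_const _),
    hind, integral_indicator_one hs] at h
  simp only [integral_const, probReal_univ, smul_eq_mul, one_mul] at h
  exact sub_eq_zero.1 h

end Measure

end SAdic

/-! ### Rounding, rational weights and conclusion. -/

namespace SAdic

theorem exp_two_pi_I_mul_pow (t : ℝ) (h : ℕ) (z : ℤ) :
    Complex.exp (2 * Real.pi * Complex.I * t) ^ h =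
      Complex.exp (Complex.I * ((2 * Real.pi * (t * h - z) : ℝ) : ℂ)) := by
  rw [← Complex.exp_nat_mul, Complex.exp_eq_exp_iff_exists_int]
  refine ⟨z, ?_⟩
  push_cast
  ring

theorem norm_exp_pow_sub_one_le (t : ℝ) (h : ℕ) (z : ℤ) :
    ‖Complex.exp (2 * Real.pi * Complex.I * t) ^ h - 1‖ ≤ 2 * Real.pi * |t * h - z| := by
  rw [exp_two_pi_I_mul_pow t h z]
  refine Real.norm_exp_I_mul_ofReal_sub_one_le.trans ?_
  rw [Real.norm_eq_abs, abs_mul, abs_of_pos Real.two_pi_pos]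

/-- The norm is `2|sin(πr)|` with `|r| ≤ 1/2`, and Jordan's inequality bounds it below by `4|r|`. -/
theorem abs_sub_round_le_norm_exp_pow_sub_one (t : ℝ) (h : ℕ) :
    |t * h - round (t * h)| ≤ ‖Complex.exp (2 * Real.pi * Complex.I * t) ^ h - 1‖ := by
  rw [exp_two_pi_I_mul_pow t h (round (t * h)), Complex.norm_exp_I_mul_ofReal_sub_one]
  set r := t * h - round (t * h) with hr
  have hr2 : |r| ≤ 1 / 2 := abs_sub_round _
  have hpi := Real.pi_pos
  have h1 : |Real.pi * r| = Real.pi * |r| := by rw [abs_mul, abs_of_pos hpi]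
  have h2 := Real.mul_abs_le_abs_sin (x := Real.pi * r) (by rw [h1]; nlinarith)
  rw [h1, ← mul_assoc, div_mul_cancel₀ _ hpi.ne'] at h2
  rw [show 2 * Real.pi * r / 2 = Real.pi * r by ring, Real.norm_eq_abs, abs_mul, abs_two]
  have := abs_nonneg r
  linarith

variable {A : Type*}

theorem weight_block_succ (σ : ℕ → Substitution A) (v : A → ℝ) (n : ℕ) (a : A) :
    weight v (block σ 0 (n + 1) a) =
      weight (fun b => weight v (block σ 0 n b)) ((σ n).toFun a) := by
  rw [block, zero_add]
  generalize (σ n).toFun a = w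
  induction w with
  | nil => simp
  | cons b w ih => rw [List.flatMap_cons, weight_append, ih, weight_cons]

theorem exists_int_weight_eq {v : A → ℝ} (hv : ∀ a, ∃ z : ℤ, v a = z) (w : List A) :
    ∃ z : ℤ, weight v w = z := by
  induction w with
  | nil => exact ⟨0, by simp⟩
  | cons a w ih =>
    obtain ⟨y, hy⟩ := hv a
    obtain ⟨z, hz⟩ := ih
    exact ⟨y + z, by rw [weight_cons, hy, hz]; push_cast; rfl⟩

theorem weight_sub (v v' : A → ℝ) (w : List A) :
    weight (fun a => v a - v' a) w = weight v w - weight v' w := by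
  induction w with
  | nil => simp
  | cons a w ih => simp only [weight_cons, ih]; ring

variable [Fintype A] [DecidableEq A]

open scoped Matrix in
-- From some level on, the nearest-integer vectors obey the same linear recursion as the heights, so
-- one solution of the linear system at that level serves all later ones.
theorem exists_rat_weights {σ : ℕ → Substitution A} (hfin : Finitary σ)
    (hinv : ∀ n, (σ n).incidence.det ≠ 0) {t : ℝ}
    (ht : ∀ a, Tendsto (fun n => Complex.exp (2 * Real.pi * Complex.I * t) ^ height σ n a)
      atTop (𝓝 1)) :
    ∃ q : A → ℚ, (Unimodular σ → ∃ m : A → ℤ, ∀ i, q i = m i) ∧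
      ∀ᶠ n in atTop, ∀ a,
        weight (fun i => (q i : ℝ)) (block σ 0 n a) = round (t * height σ n a) := by
  obtain ⟨K, hK⟩ := hfin.exists_length_le
  have hε : ∀ a, Tendsto (fun n => |t * height σ n a - round (t * height σ n a)|) atTop (𝓝 0) := by
    intro a
    refine squeeze_zero (fun n => abs_nonneg _)
      (fun n => abs_sub_round_le_norm_exp_pow_sub_one t (height σ n a)) ?_
    simpa using ((ht a).sub_const 1).norm
  -- At most `K` errors come from the letters of `σ_n(a)` and one from level `n + 1`; with this
  -- tolerance they total less than 1, which forces the two integers to coincide.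
  have hpos : 0 < 1 / ((K : ℝ) + 1) := by positivity
  have hev : ∀ᶠ n in atTop, ∀ a,
      |t * height σ n a - round (t * height σ n a)| < 1 / ((K : ℝ) + 1) := by
    rw [Filter.eventually_all]
    exact fun a => (hε a).eventually_lt_const hpos
  obtain ⟨n₀, hn₀⟩ := eventually_atTop.1 hev
  obtain ⟨q, hq, hm⟩ := exists_rat_vecMul_eq hinv n₀ fun a => round (t * height σ n₀ a)
  refine ⟨q, hm, eventually_atTop.2 ⟨n₀, fun n hn => ?_⟩⟩
  induction n, hn using Nat.le_induction with
  | base =>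
    intro a
    rw [← vecMul_incidenceProd, hq]
  | succ n hn ih =>
    intro a
    rw [weight_block_succ]
    simp only [ih]
    obtain ⟨z, hz⟩ := exists_int_weight_eq (v := fun b => ((round (t * height σ n b) : ℤ) : ℝ))
      (fun b => ⟨_, rfl⟩) ((σ n).toFun a)
    have h1 : weight (fun b => t * height σ n b - (round (t * height σ n b) : ℤ))
        ((σ n).toFun a) = t * height σ (n + 1) a - z := by
      rw [weight_sub, hz, height_succ]
      congr 1
      generalize (σ n).toFun a = w
      induction w with
      | nil => simp [wordHeight]
      | cons b w ihw =>
        rw [weight_cons, ihw]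
        simp [wordHeight, mul_add]
    have h2 := abs_weight_le (fun b => (hn₀ n hn b).le) ((σ n).toFun a)
    have h3 := hn₀ (n + 1) (by omega) a
    have h4 : (((σ n).toFun a).length : ℝ) ≤ K := by exact_mod_cast hK n a
    have h5 := mul_le_mul_of_nonneg_left h4 hpos.le
    have h6 : 1 / ((K : ℝ) + 1) * K + 1 / ((K : ℝ) + 1) = 1 := by field_simp
    rw [h1] at h2
    rw [hz]
    have h7 : |((z - round (t * height σ (n + 1) a) : ℤ) : ℝ)| < 1 := by
      push_cast
      have h8 := abs_sub_le (z : ℝ) (t * height σ (n + 1) a) (round (t * height σ (n + 1) a) : ℤ)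
      rw [abs_sub_comm (z : ℝ) (t * height σ (n + 1) a)] at h8
      linarith
    rw [← Int.cast_abs] at h7
    have h9 := Int.abs_lt_one_iff.1 (by exact_mod_cast h7)
    exact_mod_cast sub_eq_zero.1 h9

theorem isAdditiveContinuousEigenvalue_of_weights [TopologicalSpace A] [DiscreteTopology A]
    {σ : ℕ → Substitution A} (hfin : Finitary σ) (hrec : Recognizable σ)
    (hne : (levelShift σ 0).Nonempty) {u : EuclideanSpace ℝ A} (hu : ∑ i, u i = 1)
    (hsum : ∀ a, Summable fun n => distToLine σ u n a) {t : ℝ} {w : A → ℝ}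
    (ht : t = ∑ i, w i * u i)
    (hw : ∀ᶠ n in atTop, ∀ a, ∃ z : ℤ, weight w (block σ 0 n a) = z) :
    IsAdditiveContinuousEigenvalue (levelShift σ 0) t := by
  obtain ⟨K, hK⟩ := hfin.exists_length_le
  have hl : ‖Complex.exp (2 * Real.pi * Complex.I * t)‖ = 1 := by
    rw [show 2 * Real.pi * Complex.I * t = ((2 * Real.pi * t : ℝ) : ℂ) * Complex.I by
      push_cast; ring]
    exact Complex.norm_exp_ofReal_mul_I _
  have hv : ∑ i, (t - w i) * u i = 0 := by
    simp only [sub_mul, Finset.sum_sub_distrib, ← Finset.mul_sum, hu, ← ht]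
    ring
  refine isContinuousEigenvalue_of_summable hK hrec hne hl fun a => ?_
  refine Summable.of_norm_bounded_eventually_nat (((hsum a).mul_left
    ‖(WithLp.toLp 2 fun i => t - w i : EuclideanSpace ℝ A)‖).mul_left (2 * Real.pi)) ?_
  filter_upwards [hw] with n hn
  obtain ⟨z, hz⟩ := hn a
  rw [norm_norm]
  refine (norm_exp_pow_sub_one_le t (height σ n a) z).trans
    (mul_le_mul_of_nonneg_left ?_ Real.two_pi_pos.le)
  have h := abs_weight_block_le_distToLine (σ := σ) hv n a
  rwa [weight_const_sub, hz] at h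

end SAdic

theorem mainTheorem6 {A : Type*} [Fintype A] [DecidableEq A]
    [TopologicalSpace A] [DiscreteTopology A] [MeasurableSpace A] [DiscreteMeasurableSpace A]
    (σ : ℕ → SAdic.Substitution A)
    (hfin : SAdic.Finitary σ) (hstraight : SAdic.Straight σ)
    (hrec : SAdic.Recognizable σ) (hprim : SAdic.Primitive σ)
    (hinf : ∀ n, ∃ᶠ m in atTop, σ m = σ n)
    (hinv : ∀ n, (σ n).incidence.det ≠ 0)
    (u : EuclideanSpace ℝ A) (hconv : SAdic.StronglyConvergent σ u)
    (μ : Measure (ℤ → A)) (hμ : SAdic.IsInvariantProbability (SAdic.levelShift σ 0) μ)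
    (t : ℝ)
    (ht : ∀ a, Tendsto (fun n => Complex.exp (2 * Real.pi * Complex.I * t) ^ SAdic.height σ n a)
      atTop (𝓝 1)) :
    (∃ q : A → ℚ, t = ∑ a, (q a : ℝ) * SAdic.letterMeasure μ a) ∧
    (SAdic.Unimodular σ → ∃ m : A → ℤ, t = ∑ a, (m a : ℝ) * SAdic.letterMeasure μ a) ∧
    (Summable (fun n => ⨆ a, SAdic.distToLine σ u n a) →
      SAdic.IsContinuousEigenvalue (SAdic.levelShift σ 0)
        (Complex.exp (2 * Real.pi * Complex.I * t)) ∧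
      ∀ a, Summable (fun n => SAdic.distToLine σ u n a) →
        SAdic.IsAdditiveContinuousEigenvalue (SAdic.levelShift σ 0)
          (SAdic.letterMeasure μ a)) := by
  have := hμ.isProbability
  have hne : (SAdic.levelShift σ 0).Nonempty := hμ.carried.exists
  have : Nonempty A := ⟨hne.some 0⟩
  obtain ⟨q, hm, hq⟩ := SAdic.exists_rat_weights hfin hinv ht
  -- On a level-`n` block the weight of `t·1 - q` is exactly the rounding error of `t h_n(a)`, which
  -- tends to 0.
  have hzero : ∑ i, (t - q i) * u i = 0 := by
    refine hconv.sum_eq_zero_of_tendsto fun a => ?_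
    refine squeeze_zero_norm' ?_ (by simpa using ((ht a).sub_const 1).norm)
    filter_upwards [hq] with n hn
    rw [SAdic.weight_const_sub, hn a]
    exact SAdic.abs_sub_round_le_norm_exp_pow_sub_one t (SAdic.height σ n a)
  have htu : t = ∑ i, (q i : ℝ) * u i := by
    simp only [sub_mul, Finset.sum_sub_distrib, ← Finset.mul_sum, hconv.2.1, mul_one] at hzero
    exact sub_eq_zero.1 hzero
  simp only [hμ.letterMeasure_eq hconv]
  refine ⟨⟨q, htu⟩, fun hu => ?_, fun hs => ?_⟩
  · obtain ⟨m, hm⟩ := hm hu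
    exact ⟨m, by simpa [hm] using htu⟩
  · have hsum : ∀ a, Summable fun n => SAdic.distToLine σ u n a := fun a =>
      Summable.of_nonneg_of_le (fun n => Metric.infDist_nonneg)
        (fun n => le_ciSup (f := fun a => SAdic.distToLine σ u n a) (Set.finite_range _).bddAbove a)
        hs
    refine ⟨SAdic.isAdditiveContinuousEigenvalue_of_weights hfin hrec hne hconv.2.1 hsum htu
      (hq.mono fun n hn a => ⟨_, hn a⟩), fun a _ => ?_⟩
    -- The weights `e_a` count occurrences of `a`, so the pairing is an integer at every level.
    refine SAdic.isAdditiveContinuousEigenvalue_of_weights hfin hrec hne hconv.2.1 hsum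
      (w := Pi.single a 1) (by simp [Pi.single_apply]) (Eventually.of_forall fun n b => ?_)
    refine SAdic.exists_int_weight_eq (fun i => ⟨if i = a then 1 else 0, ?_⟩) _
    simp [Pi.single_apply]
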